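/- Let $\mathcal C$ be a symmetric monoidal category with unit object $I$ such that every hom-set $\mathcal C(X,Y)$ is a module over the semiring $\mathbb R_+$ of nonnegative real numbers, and such that composition and the tensor product of morphisms are bilinear. Let $\mathcal P\subseteq\mathcal C$ be a symmetric monoidal subcategory containing all objects (and all identities and structure isomorphisms), whose morphisms are called normalized. Assume that $r\mapsto r\cdot\mathrm{id}_I$ is a bijection $\mathbb R_+\to\mathcal C(I,I)$, so that $\mathcal C(I,I)=\mathbb R_+$, and that for every object $X$ there is exactly one normalized morphism $X\to I$. Let $G$ be a directed acyclic graph with a finite set $V$ of nodes and a finite set $E$ of edges (parallel edges are allowed). For each $v\in V$ fix linear orderings on the set $\mathrm{in}(v)$ of edges with target $v$ and on the set $\mathrm{out}(v)$ of edges with source $v$, and let $O_v$ be a finite set of outcomes. Label every edge $e$ by an object $X_e$ of $\mathcal C$, and every node $v$ by a $\mathcal C$-instrument, that is, by a function $$f_v : O_v\longrightarrow \mathcal C\Big(\bigotimes_{e\in\mathrm{in}(v)}X_e,\ \bigotimes_{e\in\mathrm{out}(v)}X_e\Big)\quad\text{such that}\quad \sum_{x\in O_v} f_v(x)\ \text{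 is normalized},$$ where the tensor products are taken in the chosen orders. For a joint outcome $o=(o[v])_{v\in V}\in\prod_v O_v$, regard $G$ with the edge labels $X_e$ and the node labels $f_v(o[v])$ as a string diagram in $\mathcal C$. A value of this diagram is a morphism $I\to I$ that is obtained by cutting the diagram into horizontal slices, each consisting of identity wires and either one crossing of two adjacent wires (interpreted as the symmetry) or one node (interpreted as its label), with every node of $G$ occurring exactly once, and composing these slices. Then for each $o$ there is exactly one such value; it is a number $P(o[V])\in\mathcal C(I,I)=\mathbb R_+$. The numbers $P(o[V])$ form a correlation on $G$: they are a probability distribution, $\sum_{o[V]}P(o[V])=1$, and for any finite collection of subsets $V_1,\dots,V_m\subseteq V$ whose causal pasts are pairwise disjoint, the marginals satisfy $$P(o[V_1]\cdots o[V_m])=P(o[V_1])\cdots P(o[V_m])\quad\text{for all } o.$$ Here the causal past of a set $U\subseteq V$ is the set of all nodes from which there is a directed path (possibly of length zero) to an element of $U$. -/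

import Mathlib

open CategoryTheory MonoidalCategory
open scoped NNReal

universe w u

/-- A symmetric monoidal category (the symmetry is asked for separately) in which every hom-set is
a module over the semiring of nonnegative reals, such that composition and tensor product of
morphisms are bilinear.  (Compatibility with `0` follows from that with `0 • f`.) -/
class ConeEnriched (C : Type u) [Category.{w} C] [MonoidalCategory C] where
  addCommMonoid : ∀ X Y : C, AddCommMonoid (X ⟶ Y)
  module : ∀ X Y : C, Module ℝ≥0 (X ⟶ Y)
  add_comp : ∀ {X Y Z : C} (f f' : X ⟶ Y) (g : Y ⟶ Z), (f + f') ≫ g = f ≫ g + f' ≫ g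
  comp_add : ∀ {X Y Z : C} (f : X ⟶ Y) (g g' : Y ⟶ Z), f ≫ (g + g') = f ≫ g + f ≫ g'
  smul_comp : ∀ {X Y Z : C} (r : ℝ≥0) (f : X ⟶ Y) (g : Y ⟶ Z), (r • f) ≫ g = r • (f ≫ g)
  comp_smul : ∀ {X Y Z : C} (r : ℝ≥0) (f : X ⟶ Y) (g : Y ⟶ Z), f ≫ (r • g) = r • (f ≫ g)
  add_tensor : ∀ {X₁ Y₁ X₂ Y₂ : C} (f f' : X₁ ⟶ Y₁) (g : X₂ ⟶ Y₂),
    (f + f') ⊗ₘ g = (f ⊗ₘ g) + (f' ⊗ₘ g)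
  tensor_add : ∀ {X₁ Y₁ X₂ Y₂ : C} (f : X₁ ⟶ Y₁) (g g' : X₂ ⟶ Y₂),
    f ⊗ₘ (g + g') = (f ⊗ₘ g) + (f ⊗ₘ g')
  smul_tensor : ∀ {X₁ Y₁ X₂ Y₂ : C} (r : ℝ≥0) (f : X₁ ⟶ Y₁) (g : X₂ ⟶ Y₂),
    (r • f) ⊗ₘ g = r • (f ⊗ₘ g)
  tensor_smul : ∀ {X₁ Y₁ X₂ Y₂ : C} (r : ℝ≥0) (f : X₁ ⟶ Y₁) (g : X₂ ⟶ Y₂),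
    f ⊗ₘ (r • g) = r • (f ⊗ₘ g)

attribute [reducible, instance] ConeEnriched.addCommMonoid ConeEnriched.module

/-- A directed acyclic graph with nodes `V` and edges `E`.  (A set of edges `E ⊆ V × V` is the case
in which `src` and `tgt` are the two projections.) -/
structure DAG (V E : Type*) where
  src : E → V
  tgt : E → V
  acyclic : ∀ v : V, ¬ Relation.TransGen (fun a b => ∃ e, src e = a ∧ tgt e = b) v v

namespace DAG

variable {V E : Type*}

/-- `u → v`: there is an edge from `u` to `v`. -/
def Adj (G : DAG V E) (u v : V) : Prop := ∃ e, G.src e = u ∧ G.tgt e = v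

/-- The causal past of a set of nodes: all nodes from which there is a directed path, possibly of
length zero, to an element of the set. -/
def past (G : DAG V E) (U : Set V) : Set V :=
  {u | ∃ v ∈ U, Relation.ReflTransGen G.Adj u v}

/-- Linear orderings on the (finite) sets of incoming and of outgoing edges of each node, given as
lists without repetition. -/
structure Polarization (G : DAG V E) where
  inc : V → List E
  out : V → List E
  nodup_inc : ∀ v, (inc v).Nodup
  nodup_out : ∀ v, (out v).Nodup
  mem_inc : ∀ v e, e ∈ inc v ↔ G.tgt e = v
  mem_out : ∀ v e, e ∈ out v ↔ G.src e = v

open scoped Classical in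
/-- The marginal `P(o[U])` of a function `P` of joint outcomes: the sum of `P(o')` over all joint
outcomes `o'` that agree with `o` on `U`. -/
noncomputable def marginal [Fintype V] {O : V → Type*} [∀ v, Fintype (O v)]
    (P : (∀ v, O v) → ℝ≥0) (U : Set V) (o : ∀ v, O v) : ℝ≥0 :=
  ∑ o' : (∀ v, O v), if ∀ v ∈ U, o' v = o v then P o' else 0

open scoped Classical in
/-- `P` is a probability distribution on joint outcomes such that, whenever finitely many sets of
nodes have pairwise disjoint causal pasts, their outcomes are jointly independent. -/
def IsCorrelation [Fintype V] (G : DAG V E) {O : V → Type*} [∀ v, Fintype (O v)]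
    (P : (∀ v, O v) → ℝ≥0) : Prop :=
  ∑ o : (∀ v, O v), P o = 1 ∧
  ∀ (m : ℕ) (U : Fin m → Set V),
    (∀ i j, i ≠ j → Disjoint (G.past (U i)) (G.past (U j))) →
    ∀ o : (∀ v, O v), marginal P (⋃ i, U i) o = ∏ i, marginal P (U i) o

end DAG

namespace Diagram

variable {V E : Type*} {C : Type u} [Category.{w} C] [MonoidalCategory C]

/-- The iterated tensor product of the objects that label a list of edges. -/
def tensorList (X : E → C) : List E → C
  | [] => 𝟙_ C
  | e :: L => X e ⊗ tensorList X L

/-- The coherence isomorphism from the tensor product over a concatenation of lists. -/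
def appendIso (X : E → C) : ∀ L M : List E, tensorList X (L ++ M) ≅ tensorList X L ⊗ tensorList X M
  | [], M => (λ_ (tensorList X M)).symm
  | e :: L, M => whiskerLeftIso (X e) (appendIso X L M) ≪≫ (α_ (X e) (tensorList X L) (tensorList X M)).symm

/-- Put the wires of the list `L` to the left of a morphism. -/
def padLeft (X : E → C) {A B : List E} (f : tensorList X A ⟶ tensorList X B) :
    ∀ L : List E, tensorList X (L ++ A) ⟶ tensorList X (L ++ B)
  | [] => f
  | e :: L => X e ◁ padLeft X f L

/-- Put the wires of the list `M` to the right of a morphism. -/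
def padRight (X : E → C) {A B : List E} (f : tensorList X A ⟶ tensorList X B) (M : List E) :
    tensorList X (A ++ M) ⟶ tensorList X (B ++ M) :=
  (appendIso X A M).hom ≫ f ▷ tensorList X M ≫ (appendIso X B M).inv

/-- The crossing of the first two wires. -/
def cross [BraidedCategory C] (X : E → C) (a b : E) (M : List E) :
    tensorList X (a :: b :: M) ⟶ tensorList X (b :: a :: M) :=
  (α_ (X a) (X b) (tensorList X M)).inv ≫ (β_ (X a) (X b)).hom ▷ tensorList X M ≫
    (α_ (X b) (X a) (tensorList X M)).hom

/-- Evaluation of the part of a labelled graph below a horizontal cut.  The graph is built from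
horizontal slices, each of which contains either one crossing of two adjacent wires or one node,
next to identity wires.  `PartialValue pol X g S L s` says that some sequence of slices that uses
exactly the nodes in `S`, each of them once, ends in the list `L` of open wires and composes to the
morphism `s : I ⟶ ⨂ L`. -/
inductive PartialValue [BraidedCategory C] [DecidableEq V] {G : DAG V E} (pol : G.Polarization)
    (X : E → C) (g : ∀ v, tensorList X (pol.inc v) ⟶ tensorList X (pol.out v)) :
    Finset V → ∀ L : List E, (𝟙_ C ⟶ tensorList X L) → Prop
  | empty : PartialValue pol X g ∅ [] (𝟙 (𝟙_ C))
  | crossing (S : Finset V) (L M : List E) (a b : E) (s : 𝟙_ C ⟶ tensorList X (L ++ a :: b :: M)) :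
      PartialValue pol X g S (L ++ a :: b :: M) s →
      PartialValue pol X g S (L ++ b :: a :: M) (s ≫ padLeft X (cross X a b M) L)
  | node (S : Finset V) (v : V) (L M : List E) (s : 𝟙_ C ⟶ tensorList X (L ++ (pol.inc v ++ M))) :
      v ∉ S → PartialValue pol X g S (L ++ (pol.inc v ++ M)) s →
      PartialValue pol X g (insert v S) (L ++ (pol.out v ++ M))
        (s ≫ padLeft X (padRight X (g v) M) L)

/-- `z : I ⟶ I` is a value of the graph (without boundary) whose edges are labelled by the objects
`X e` and whose nodes are labelled by the morphisms `g v`. -/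
def IsValue [BraidedCategory C] [Fintype V] [DecidableEq V] {G : DAG V E} (pol : G.Polarization)
    (X : E → C) (g : ∀ v, tensorList X (pol.inc v) ⟶ tensorList X (pol.out v)) (z : 𝟙_ C ⟶ 𝟙_ C) : Prop :=
  PartialValue pol X g Finset.univ [] z

end Diagram

/-! An acyclic graph can be assembled node by node, so a value exists. It does not depend on the
slicing, for two reasons. A permutation of distinct wires has only one interpretation: pulling one
wire to the front is a normal form (`PermHom.exists_pull`), which settles the wires one at a time
(`PermHom.unique`). And two slicings that end with different nodes are compared through a common
earlier stage after which both nodes can be applied in either order, by the interchange law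
(`FrontValue.eq_comp`).

A fixed slicing makes the value multilinear in the labels. So a marginal on `U` is the value of the
diagram in which every node outside `U` carries the sum over its outcomes, a normalized morphism.
Each object has exactly one normalized morphism to the unit, so discarding absorbs a normalized node
(`IsDiscardedValue.insert`), and only the causal past of `U` matters (`IsDiscardedValue.mono`).
Diagrams on disjoint pasts stand side by side and their scalars multiply (`IsDiscardedValue.union`),
which is independence. Starting from the empty set of nodes, the same absorption gives total mass 1.
-/

namespace Diagram

/-! ### Padding by identity wires and the interchange law. -/

section Wires

variable {E : Type*} {C : Type u} [Category.{w} C] [MonoidalCategory C]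

/-- Put one wire to the left of a morphism. -/
def consHom (X : E → C) (e : E) {A B : List E} (f : tensorList X A ⟶ tensorList X B) :
    tensorList X (e :: A) ⟶ tensorList X (e :: B) :=
  X e ◁ f

@[simp]
theorem consHom_id (X : E → C) (e : E) (A : List E) :
    consHom X e (𝟙 (tensorList X A)) = 𝟙 (tensorList X (e :: A)) :=
  whiskerLeft_id _ _

theorem consHom_comp (X : E → C) (e : E) {A B M : List E} (f : tensorList X A ⟶ tensorList X B)
    (g : tensorList X B ⟶ tensorList X M) :
    consHom X e (f ≫ g) = consHom X e f ≫ consHom X e g :=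
  whiskerLeft_comp _ _ _

theorem padLeft_cons (X : E → C) {A B : List E} (f : tensorList X A ⟶ tensorList X B) (e : E)
    (L : List E) : padLeft X f (e :: L) = consHom X e (padLeft X f L) :=
  rfl

theorem padLeft_eq (X : E → C) {A B : List E} (f : tensorList X A ⟶ tensorList X B) (L : List E) :
    padLeft X f L = (appendIso X L A).hom ≫ tensorList X L ◁ f ≫ (appendIso X L B).inv := by
  induction L with
  | nil => simp [padLeft, appendIso, tensorList]
  | cons e L ih => simp [padLeft, appendIso, tensorList, ih]

theorem padRight_add [ConeEnriched C] (X : E → C) {A B : List E}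
    (f f' : tensorList X A ⟶ tensorList X B) (M : List E) :
    padRight X (f + f') M = padRight X f M + padRight X f' M := by
  simp only [padRight, ← tensorHom_id, ConeEnriched.add_tensor, ConeEnriched.add_comp,
    ConeEnriched.comp_add]

theorem padRight_smul [ConeEnriched C] (X : E → C) {A B : List E} (r : ℝ≥0)
    (f : tensorList X A ⟶ tensorList X B) (M : List E) :
    padRight X (r • f) M = r • padRight X f M := by
  simp only [padRight, ← tensorHom_id, ConeEnriched.smul_tensor, ConeEnriched.smul_comp,
    ConeEnriched.comp_smul]

/-- Morphisms on disjoint blocks of wires commute. -/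
theorem padLeft_comp_padRight (X : E → C) {A B M N : List E}
    (f : tensorList X A ⟶ tensorList X B) (p : tensorList X M ⟶ tensorList X N) :
    padLeft X p A ≫ padRight X f N = padRight X f M ≫ padLeft X p B := by
  simp [padLeft_eq, padRight, whisker_exchange_assoc]

/-- The comparison of the two bracketings of a concatenation of three lists. -/
def appendAssocIso (X : E → C) : ∀ A B M : List E,
    tensorList X ((A ++ B) ++ M) ≅ tensorList X (A ++ (B ++ M))
  | [], _, _ => Iso.refl _
  | a :: A, B, M => whiskerLeftIso (X a) (appendAssocIso X A B M)

/-- Needed for `padRight_padRight`. The recursive `appendAssocIso` replaces a cast along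
associativity of lists, so the induction step is `ih` whiskered by one wire. -/
theorem appendIso_assoc (X : E → C) (A B M : List E) :
    (appendAssocIso X A B M).hom ≫ (appendIso X A (B ++ M)).hom ≫
      tensorList X A ◁ (appendIso X B M).hom =
    (appendIso X (A ++ B) M).hom ≫ (appendIso X A B).hom ▷ tensorList X M ≫
      (α_ (tensorList X A) (tensorList X B) (tensorList X M)).hom := by
  induction A with
  | nil => simp [appendAssocIso, appendIso, tensorList]
  | cons a A ih =>
    have h := congrArg (fun t => X a ◁ t) ih
    simp only [whiskerLeft_comp] at h
    simp only [appendAssocIso, appendIso, List.cons_append, tensorList, Iso.trans_hom,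
      whiskerLeftIso_hom, Iso.symm_hom, Category.assoc, comp_whiskerRight]
    rw [tensor_whiskerLeft]
    simp only [Iso.inv_hom_id_assoc]
    rw [reassoc_of% h]
    simp

theorem padRight_padRight (X : E → C) {A B : List E} (f : tensorList X A ⟶ tensorList X B)
    (M K : List E) :
    padRight X (padRight X f M) K = (appendAssocIso X A M K).hom ≫ padRight X f (M ++ K) ≫
      (appendAssocIso X B M K).inv := by
  have hA : (appendIso X (A ++ M) K).hom = (appendAssocIso X A M K).hom ≫
      (appendIso X A (M ++ K)).hom ≫ tensorList X A ◁ (appendIso X M K).hom ≫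
      (α_ _ _ _).inv ≫ (appendIso X A M).inv ▷ tensorList X K := by
    have := appendIso_assoc X A M K
    rw [reassoc_of% this]; simp
  have hB : (appendIso X (B ++ M) K).inv = (appendIso X B M).hom ▷ tensorList X K ≫
      (α_ _ _ _).hom ≫ tensorList X B ◁ (appendIso X M K).inv ≫ (appendIso X B (M ++ K)).inv ≫
      (appendAssocIso X B M K).inv := by
    have := congrArg (fun i => i.inv) (Iso.ext (α := appendAssocIso X B M K ≪≫ appendIso X B (M ++ K) ≪≫
      whiskerLeftIso _ (appendIso X M K)) (β := appendIso X (B ++ M) K ≪≫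
      whiskerRightIso (appendIso X B M) _ ≪≫ α_ _ _ _) (by simpa using appendIso_assoc X B M K))
    simp only [Iso.trans_inv, whiskerLeftIso_inv, whiskerRightIso_inv, Category.assoc] at this
    rw [this]; simp
  simp only [padRight]
  rw [hA, hB]
  simp only [comp_whiskerRight, Category.assoc, inv_hom_whiskerRight_assoc]
  rw [associator_naturality_left_assoc, Iso.inv_hom_id_assoc, whisker_exchange_assoc,
    whiskerLeft_hom_inv_assoc]

end Wires

/-! ### Coherence: permutations of distinct wires. -/

section Crossings

variable {E : Type*} {C : Type u} [Category.{w} C] [MonoidalCategory C]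

theorem cross_naturality [BraidedCategory C] (X : E → C) (a b : E) {M N : List E}
    (p : tensorList X M ⟶ tensorList X N) :
    consHom X a (consHom X b p) ≫ cross X a b N = cross X a b M ≫ consHom X b (consHom X a p) := by
  -- Stated for arbitrary objects, because `tensorList` of a cons is a tensor product only after
  -- unfolding.
  have key : ∀ (A B : C) {Y Z : C} (p : Y ⟶ Z), A ◁ B ◁ p ≫ (α_ A B Z).inv ≫
      (β_ A B).hom ▷ Z ≫ (α_ B A Z).hom =
      ((α_ A B Y).inv ≫ (β_ A B).hom ▷ Y ≫ (α_ B A Y).hom) ≫ B ◁ A ◁ p := by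
    intro A B Y Z p
    rw [associator_inv_naturality_right_assoc, whisker_exchange_assoc,
      associator_naturality_right, Category.assoc, Category.assoc]
  exact key _ _ p

theorem cross_cross [SymmetricCategory C] (X : E → C) (a b : E) (M : List E) :
    cross X a b M ≫ cross X b a M = 𝟙 _ := by
  have key : ∀ A B Y : C, ((α_ A B Y).inv ≫ (β_ A B).hom ▷ Y ≫ (α_ B A Y).hom) ≫
      (α_ B A Y).inv ≫ (β_ B A).hom ▷ Y ≫ (α_ A B Y).hom = 𝟙 _ := by
    intro A B Y
    simp [← comp_whiskerRight_assoc]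
  exact key _ _ _

theorem cross_yang_baxter [BraidedCategory C] (X : E → C) (a b e : E) (M : List E) :
    cross X a b (e :: M) ≫ consHom X b (cross X a e M) ≫ cross X b e (a :: M) =
      consHom X a (cross X b e M) ≫ cross X a e (b :: M) ≫ consHom X e (cross X a b M) := by
  have key : ∀ A B D Y : C,
      ((α_ A B (D ⊗ Y)).inv ≫ (β_ A B).hom ▷ (D ⊗ Y) ≫ (α_ B A (D ⊗ Y)).hom) ≫
      B ◁ ((α_ A D Y).inv ≫ (β_ A D).hom ▷ Y ≫ (α_ D A Y).hom) ≫
      ((α_ B D (A ⊗ Y)).inv ≫ (β_ B D).hom ▷ (A ⊗ Y) ≫ (α_ D B (A ⊗ Y)).hom) =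
      A ◁ ((α_ B D Y).inv ≫ (β_ B D).hom ▷ Y ≫ (α_ D B Y).hom) ≫
      ((α_ A D (B ⊗ Y)).inv ≫ (β_ A D).hom ▷ (B ⊗ Y) ≫ (α_ D A (B ⊗ Y)).hom) ≫
      D ◁ ((α_ A B Y).inv ≫ (β_ A B).hom ▷ Y ≫ (α_ B A Y).hom) := by
    intro A B D Y
    calc
      _ = 𝟙 _ ⊗≫ ((β_ A B).hom ▷ D ⊗≫ B ◁ (β_ A D).hom ⊗≫ (β_ B D).hom ▷ A) ▷ Y ⊗≫ 𝟙 _ := by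
        monoidal
      _ = _ := by rw [BraidedCategory.yang_baxter']; monoidal
  exact key _ _ _ _

/-- The morphisms that are composed of crossings of adjacent wires. -/
inductive PermHom [BraidedCategory C] (X : E → C) :
    ∀ L L' : List E, (tensorList X L ⟶ tensorList X L') → Prop
  | refl (L : List E) : PermHom X L L (𝟙 _)
  | cross (a b : E) (M : List E) : PermHom X (a :: b :: M) (b :: a :: M) (cross X a b M)
  | cons (e : E) {L L' : List E} {p : tensorList X L ⟶ tensorList X L'} :
      PermHom X L L' p → PermHom X (e :: L) (e :: L') (consHom X e p)
  | trans {L L' L'' : List E} {p : tensorList X L ⟶ tensorList X L'}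
      {q : tensorList X L' ⟶ tensorList X L''} :
      PermHom X L L' p → PermHom X L' L'' q → PermHom X L L'' (p ≫ q)

/-- Moving the wire `e` to the front. -/
inductive Pull [BraidedCategory C] (X : E → C) (e : E) :
    ∀ L M : List E, (tensorList X L ⟶ tensorList X (e :: M)) → Prop
  | head (M : List E) : Pull X e (e :: M) M (𝟙 _)
  | tail (a : E) {L M : List E} {p : tensorList X L ⟶ tensorList X (e :: M)} :
      Pull X e L M p → Pull X e (a :: L) (a :: M) (consHom X a p ≫ Diagram.cross X a e M)

theorem Pull.mem [BraidedCategory C] {X : E → C} {e : E} {L M : List E}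
    {p : tensorList X L ⟶ tensorList X (e :: M)} (h : Pull X e L M p) : e ∈ L := by
  induction h <;> simp_all

/-- In a list without repetition there is only one occurrence of `e` to move. The codomains mention
`M` and `M'`, hence `HEq`. -/
theorem Pull.unique [BraidedCategory C] {X : E → C} {e : E} {L M M' : List E}
    {p : tensorList X L ⟶ tensorList X (e :: M)} {p' : tensorList X L ⟶ tensorList X (e :: M')}
    (h : Pull X e L M p) (h' : Pull X e L M' p') (hL : L.Nodup) : M = M' ∧ HEq p p' := by
  induction h generalizing M' with
  | head M =>
    cases h' with
    | head => exact ⟨rfl, HEq.rfl⟩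
    | tail _ h' => exact absurd h'.mem (List.nodup_cons.1 hL).1
  | tail a h ih =>
    cases h' with
    | head => exact absurd h.mem (List.nodup_cons.1 hL).1
    | tail _ h' =>
      obtain ⟨rfl, hp⟩ := ih h' (List.nodup_cons.1 hL).2
      cases hp
      exact ⟨rfl, HEq.rfl⟩

theorem PermHom.perm [BraidedCategory C] {X : E → C} {L L' : List E}
    {p : tensorList X L ⟶ tensorList X L'} (h : PermHom X L L' p) : L.Perm L' := by
  induction h with
  | refl => exact .refl _
  | cross => exact .swap _ _ _
  | cons _ _ ih => exact ih.cons _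
  | trans _ _ ih ih' => exact ih.trans ih'

theorem PermHom.exists_of_perm [BraidedCategory C] (X : E → C) {L L' : List E} (h : L.Perm L') :
    ∃ p, PermHom X L L' p := by
  induction h with
  | nil => exact ⟨_, .refl _⟩
  | cons e _ ih => exact ⟨_, .cons e ih.choose_spec⟩
  | swap a b M => exact ⟨_, .cross b a M⟩
  | trans _ _ ih ih' => exact ⟨_, ih.choose_spec.trans ih'.choose_spec⟩

/-- Extraction of a wire commutes with each generator. Under `cons` this is naturality of the
crossing. For a crossing, it is immediate, symmetry or Yang–Baxter, according to whether `e` is the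
first wire after the crossing, the second, or a later one. -/
theorem PermHom.exists_pull [SymmetricCategory C] {X : E → C} {L L' : List E}
    {c : tensorList X L ⟶ tensorList X L'} (h : PermHom X L L' c) {e : E} {M' : List E}
    {p' : tensorList X L' ⟶ tensorList X (e :: M')} (hp : Pull X e L' M' p') :
    ∃ M p c', Pull X e L M p ∧ PermHom X M M' c' ∧ c ≫ p' = p ≫ consHom X e c' := by
  induction h generalizing M' with
  | refl L => exact ⟨M', p', 𝟙 _, hp, .refl _, by simp⟩
  | trans _ _ ih ih' =>
    obtain ⟨M, p, c', h1, h2, h3⟩ := ih' hp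
    obtain ⟨K, q, d', h4, h5, h6⟩ := ih h1
    exact ⟨K, q, _, h4, h5.trans h2, by rw [Category.assoc, h3, reassoc_of% h6, consHom_comp]⟩
  | cons a h ih =>
    cases hp with
    | head => exact ⟨_, _, _, .head _, h, by simp⟩
    | tail _ hp =>
      obtain ⟨M, p, c', h1, h2, h3⟩ := ih hp
      refine ⟨_, _, _, .tail a h1, h2.cons a, ?_⟩
      rw [← Category.assoc, ← consHom_comp, h3, consHom_comp, Category.assoc, Category.assoc,
        cross_naturality]
  | cross a b M =>
    cases hp with
    | head => exact ⟨_, _, _, .tail a (.head _), .refl _, by simp⟩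
    | tail _ hp =>
      cases hp with
      | head => exact ⟨_, _, _, .head _, .refl _, by simp [cross_cross]⟩
      | tail _ hp =>
        refine ⟨_, _, _, .tail _ (.tail _ hp), .cross _ _ _, ?_⟩
        simp only [consHom_comp, Category.assoc]
        rw [← cross_yang_baxter, ← reassoc_of% cross_naturality]

/-- Extracting the first wire of `L'` writes `c` and `d` as the same pull followed by permutations
of shorter lists. With a repeated wire this may fail: two equal labels can be crossed or not. -/
theorem PermHom.unique [SymmetricCategory C] {X : E → C} {L L' : List E}
    {c d : tensorList X L ⟶ tensorList X L'} (hc : PermHom X L L' c) (hd : PermHom X L L' d)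
    (hL : L.Nodup) : c = d := by
  induction L' generalizing L with
  | nil =>
    -- The middle list of a `trans` is only propositionally empty, so the identity is generalized to
    -- `eqToHom`.
    have key : ∀ {L L' : List E} {c : tensorList X L ⟶ tensorList X L'}, PermHom X L L' c →
        ∀ (h : L = []) (h' : L' = []), c = eqToHom (by rw [h, h']) := by
      intro L L' c hc
      induction hc with
      | refl => simp
      | cross => simp
      | cons => simp
      | trans h1 h2 ih ih' =>
        intro h h'
        have := h1.perm
        subst h
        rw [ih rfl (List.nil_perm.1 this), ih' (List.nil_perm.1 this) h', eqToHom_trans]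
    have := List.perm_nil.1 hc.perm
    rw [key hc this rfl, key hd this rfl]
  | cons e M' ih =>
    obtain ⟨M, p, c', h1, h2, h3⟩ := hc.exists_pull (.head M')
    obtain ⟨M1, p1, d', h4, h5, h6⟩ := hd.exists_pull (.head M')
    obtain ⟨rfl, hp⟩ := h1.unique h4 hL
    cases hp
    have hM : (e :: M').Nodup := hc.perm.nodup_iff.1 hL
    have : M.Nodup := h2.perm.nodup_iff.2 (List.nodup_cons.1 hM).2
    cases ih h2 h5 this
    simpa using h3.trans h6.symm

end Crossings

/-! ### Moving a node through a block of wires. -/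

section BlockSwap

variable {E : Type*} {C : Type u} [Category.{w} C] [MonoidalCategory C]

theorem PermHom.padLeft [BraidedCategory C] {X : E → C} {A B : List E}
    {p : tensorList X A ⟶ tensorList X B} (h : PermHom X A B p) (L : List E) :
    PermHom X (L ++ A) (L ++ B) (padLeft X p L) := by
  induction L with
  | nil => exact h
  | cons e L ih => exact ih.cons e

theorem padRight_id (X : E → C) (A M : List E) :
    padRight X (𝟙 (tensorList X A)) M = 𝟙 (tensorList X (A ++ M)) := by
  simp [padRight]

theorem padRight_comp (X : E → C) {A B D : List E} (f : tensorList X A ⟶ tensorList X B)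
    (g : tensorList X B ⟶ tensorList X D) (M : List E) :
    padRight X (f ≫ g) M = padRight X f M ≫ padRight X g M := by
  simp [padRight]

theorem padRight_consHom (X : E → C) (e : E) {A B : List E}
    (f : tensorList X A ⟶ tensorList X B) (M : List E) :
    padRight X (consHom X e f) M = consHom X e (padRight X f M) := by
  have key : ∀ (Y : C) {A B M P Q : C} (f : A ⟶ B) (i : P ⟶ A ⊗ M) (j : B ⊗ M ⟶ Q),
      (Y ◁ i ≫ (α_ Y A M).inv) ≫ (Y ◁ f) ▷ M ≫ (α_ Y B M).hom ≫ Y ◁ j =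
      Y ◁ (i ≫ f ▷ M ≫ j) := by
    intros
    simp
  exact key _ _ _ _

theorem padRight_cross [BraidedCategory C] (X : E → C) (a b : E) (L M : List E) :
    padRight X (cross X a b L) M = cross X a b (L ++ M) := by
  have key : ∀ (A B : C) {Y M P : C} (i : P ≅ Y ⊗ M),
      (A ◁ (B ◁ i.hom ≫ (α_ B Y M).inv) ≫ (α_ A (B ⊗ Y) M).inv) ≫
      ((α_ A B Y).inv ≫ (β_ A B).hom ▷ Y ≫ (α_ B A Y).hom) ▷ M ≫
      (α_ B (A ⊗ Y) M).hom ≫ B ◁ ((α_ A Y M).hom ≫ A ◁ i.inv) =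
      (α_ A B P).inv ≫ (β_ A B).hom ▷ P ≫ (α_ B A P).hom := by
    intro A B Y M P i
    have : (A ⊗ B) ◁ i.hom ≫ (β_ A B).hom ▷ (Y ⊗ M) ≫ (B ⊗ A) ◁ i.inv = (β_ A B).hom ▷ P := by
      rw [whisker_exchange_assoc]; simp
    rw [← this]
    monoidal
  have := key (X a) (X b) (appendIso X L M)
  simp only [padRight, appendIso, cross]
  convert! this using 3

theorem PermHom.padRight [BraidedCategory C] {X : E → C} {A B : List E}
    {p : tensorList X A ⟶ tensorList X B} (h : PermHom X A B p) (M : List E) :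
    PermHom X (A ++ M) (B ++ M) (padRight X p M) := by
  induction h with
  | refl L => rw [padRight_id]; exact .refl _
  | cross a b L => rw [padRight_cross]; exact .cross a b (L ++ M)
  | cons e h ih => rw [padRight_consHom]; exact ih.cons e
  | trans _ _ ih ih' => rw [padRight_comp]; exact ih.trans ih'

theorem permHom_appendAssocIso_hom [BraidedCategory C] (X : E → C) (A B M : List E) :
    PermHom X ((A ++ B) ++ M) (A ++ (B ++ M)) (appendAssocIso X A B M).hom := by
  induction A with
  | nil => exact .refl _
  | cons a A ih => exact ih.cons a

theorem permHom_appendAssocIso_inv [BraidedCategory C] (X : E → C) (A B M : List E) :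
    PermHom X (A ++ (B ++ M)) ((A ++ B) ++ M) (appendAssocIso X A B M).inv := by
  induction A with
  | nil => exact .refl _
  | cons a A ih => exact ih.cons a

/-- Moving the first wire past a block of wires. -/
def wireSwap [BraidedCategory C] (X : E → C) (e : E) : ∀ B M : List E,
    tensorList X (e :: (B ++ M)) ⟶ tensorList X (B ++ e :: M)
  | [], _ => 𝟙 _
  | b :: B, M => cross X e b (B ++ M) ≫ consHom X b (wireSwap X e B M)

theorem permHom_wireSwap [BraidedCategory C] (X : E → C) (e : E) (B M : List E) :
    PermHom X (e :: (B ++ M)) (B ++ e :: M) (wireSwap X e B M) := by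
  induction B with
  | nil => exact .refl _
  | cons b B ih => exact .trans (.cross e b _) (ih.cons b)

/-- Crossing the wires of a block one by one is a single braiding with their tensor product: the
hexagon identity adds one wire, and the empty block is the braiding with the unit. -/
theorem wireSwap_comp_appendIso [BraidedCategory C] (X : E → C) (e : E) (B M : List E) :
    wireSwap X e B M ≫ (appendIso X B (e :: M)).hom =
      X e ◁ (appendIso X B M).hom ≫ (α_ (X e) (tensorList X B) (tensorList X M)).inv ≫
        (β_ (X e) (tensorList X B)).hom ▷ tensorList X M ≫ (α_ _ _ _).hom := by
  induction B with
  | nil =>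
    have key : ∀ A Y : C, 𝟙 _ ≫ (λ_ (A ⊗ Y)).inv = A ◁ (λ_ Y).inv ≫ (α_ A (𝟙_ C) Y).inv ≫
        (β_ A (𝟙_ C)).hom ▷ Y ≫ (α_ (𝟙_ C) A Y).hom := by
      intro A Y
      rw [braiding_tensorUnit_right]
      monoidal
    exact key _ _
  | cons b B ih =>
    have key : ∀ (A B D M : C) {P Q : C} (i : P ⟶ D ⊗ M) (s : A ⊗ P ⟶ Q) (j : Q ⟶ D ⊗ A ⊗ M),
        s ≫ j = A ◁ i ≫ (α_ A D M).inv ≫ (β_ A D).hom ▷ M ≫ (α_ D A M).hom →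
        (((α_ A B P).inv ≫ (β_ A B).hom ▷ P ≫ (α_ B A P).hom) ≫ B ◁ s) ≫
          B ◁ j ≫ (α_ B D (A ⊗ M)).inv =
        A ◁ (B ◁ i ≫ (α_ B D M).inv) ≫ (α_ A (B ⊗ D) M).inv ≫ (β_ A (B ⊗ D)).hom ▷ M ≫
          (α_ (B ⊗ D) A M).hom := by
      intro A B D M P Q i s j h
      rw [Category.assoc, ← whiskerLeft_comp_assoc, h, BraidedCategory.braiding_tensor_right_hom]
      calc
        _ = 𝟙 _ ⊗≫ ((β_ A B).hom ▷ P ≫ (B ⊗ A) ◁ i) ⊗≫ B ◁ (β_ A D).hom ▷ M ⊗≫ 𝟙 _ := by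
          monoidal
        _ = _ := by rw [← whisker_exchange]; monoidal
    exact key _ _ _ _ _ _ _ ih

theorem wireSwap_naturality [BraidedCategory C] (X : E → C) (e : E) {A B : List E}
    (f : tensorList X A ⟶ tensorList X B) (M : List E) :
    consHom X e (padRight X f M) ≫ wireSwap X e B M =
      wireSwap X e A M ≫ padRight X f (e :: M) := by
  have key : ∀ (Y : C) {A B M P Q P' Q' : C} (f : A ⟶ B) (i : P ≅ A ⊗ M) (j : Q ≅ B ⊗ M)
      (i' : P' ≅ A ⊗ (Y ⊗ M)) (j' : Q' ≅ B ⊗ (Y ⊗ M)) (s : Y ⊗ P ⟶ P') (t : Y ⊗ Q ⟶ Q'),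
      s ≫ i'.hom = Y ◁ i.hom ≫ (α_ Y A M).inv ≫ (β_ Y A).hom ▷ M ≫ (α_ A Y M).hom →
      t ≫ j'.hom = Y ◁ j.hom ≫ (α_ Y B M).inv ≫ (β_ Y B).hom ▷ M ≫ (α_ B Y M).hom →
      Y ◁ (i.hom ≫ f ▷ M ≫ j.inv) ≫ t = s ≫ i'.hom ≫ f ▷ (Y ⊗ M) ≫ j'.inv := by
    intro Y A B M P Q P' Q' f i j i' j' s t hs ht
    rw [← cancel_mono j'.hom, Category.assoc, ht, reassoc_of% hs]
    have h : (Y ◁ f) ▷ M ≫ (β_ Y B).hom ▷ M = (β_ Y A).hom ▷ M ≫ (f ▷ Y) ▷ M := by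
      rw [← comp_whiskerRight, BraidedCategory.braiding_naturality_right, comp_whiskerRight]
    simp only [whiskerLeft_comp, Category.assoc, whiskerLeft_inv_hom_assoc, Iso.inv_hom_id,
      Category.comp_id]
    rw [associator_inv_naturality_middle_assoc, reassoc_of% h, associator_naturality_left]
  exact key _ _ _ _ _ _ _ _ (wireSwap_comp_appendIso X e A M) (wireSwap_comp_appendIso X e B M)

/-- The crossing of two adjacent blocks of wires. -/
def blockSwap [BraidedCategory C] (X : E → C) : ∀ L B M : List E,
    tensorList X (L ++ (B ++ M)) ⟶ tensorList X (B ++ (L ++ M))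
  | [], _, _ => 𝟙 _
  | e :: L, B, M => consHom X e (blockSwap X L B M) ≫ wireSwap X e B (L ++ M)

theorem permHom_blockSwap [BraidedCategory C] (X : E → C) (L B M : List E) :
    PermHom X (L ++ (B ++ M)) (B ++ (L ++ M)) (blockSwap X L B M) := by
  induction L with
  | nil => exact .refl _
  | cons e L ih => exact (ih.cons e).trans (permHom_wireSwap X e B (L ++ M))

theorem blockSwap_naturality [BraidedCategory C] (X : E → C) {A B : List E}
    (f : tensorList X A ⟶ tensorList X B) (L M : List E) :
    padLeft X (padRight X f M) L ≫ blockSwap X L B M =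
      blockSwap X L A M ≫ padRight X f (L ++ M) := by
  induction L with
  | nil => simp [blockSwap, padLeft]
  | cons e L ih =>
    simp only [blockSwap, padLeft_cons, List.cons_append, Category.assoc]
    rw [← wireSwap_naturality, ← Category.assoc, ← Category.assoc, ← consHom_comp, ← consHom_comp,
      ih]

end BlockSwap

end Diagram

theorem List.Nodup.exists_perm_append_of_subset {E : Type*} {l L : List E} (hl : l.Nodup)
    (h : l ⊆ L) : ∃ M, L.Perm (l ++ M) := by
  obtain ⟨l', hl', hL⟩ := hl.subperm h
  obtain ⟨M, hM⟩ := hL.exists_perm_append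
  exact ⟨M, hM.trans (hl'.append_right M)⟩

namespace Diagram

/-! ### Values with nodes at the front, and their open wires. -/

section Values

variable {V E : Type*} {C : Type u} [Category.{w} C] [MonoidalCategory C]

/-- A variant of `PartialValue` in which nodes are applied to the first wires only, and any
composite of crossings may be applied in one slice. -/
inductive FrontValue [BraidedCategory C] [DecidableEq V] {G : DAG V E} (pol : G.Polarization)
    (X : E → C) (g : ∀ v, tensorList X (pol.inc v) ⟶ tensorList X (pol.out v)) :
    Finset V → ∀ L : List E, (𝟙_ C ⟶ tensorList X L) → Prop
  | empty : FrontValue pol X g ∅ [] (𝟙 (𝟙_ C))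
  | perm {S : Finset V} {L L' : List E} {s : 𝟙_ C ⟶ tensorList X L}
      {p : tensorList X L ⟶ tensorList X L'} :
      FrontValue pol X g S L s → PermHom X L L' p → FrontValue pol X g S L' (s ≫ p)
  | node {S : Finset V} {v : V} {M : List E} {s : 𝟙_ C ⟶ tensorList X (pol.inc v ++ M)} :
      v ∉ S → FrontValue pol X g S (pol.inc v ++ M) s →
      FrontValue pol X g (insert v S) (pol.out v ++ M) (s ≫ padRight X (g v) M)

/-- `L` lists, without repetition, the edges that leave the set of nodes `S`, and no edge enters
`S`. -/
structure IsBoundary (G : DAG V E) (S : Finset V) (L : List E) : Prop where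
  nodup : L.Nodup
  mem_iff : ∀ e, e ∈ L ↔ G.src e ∈ S ∧ G.tgt e ∉ S
  closed : ∀ e, G.tgt e ∈ S → G.src e ∈ S

theorem IsBoundary.perm {G : DAG V E} {S : Finset V} {L L' : List E} (h : IsBoundary G S L)
    (h' : L.Perm L') : IsBoundary G S L' :=
  ⟨h'.nodup_iff.1 h.nodup, fun e => by rw [← h'.mem_iff, h.mem_iff], h.closed⟩

theorem IsBoundary.perm_of {G : DAG V E} {S : Finset V} {L L' : List E} (h : IsBoundary G S L)
    (h' : IsBoundary G S L') : L.Perm L' :=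
  (List.perm_ext_iff_of_nodup h.nodup h'.nodup).2 fun e => by rw [h.mem_iff, h'.mem_iff]

theorem src_ne_tgt (G : DAG V E) (e : E) : G.src e ≠ G.tgt e :=
  fun h => G.acyclic (G.src e) (.single ⟨e, rfl, h.symm⟩)

/-- All outgoing edges of `v` become open: none ends in `S`, which contains the source of any edge
ending in it but not `v`, and none ends at `v`, by acyclicity. -/
theorem IsBoundary.insert [DecidableEq V] {G : DAG V E} (pol : G.Polarization) {S : Finset V}
    {v : V} {M : List E} (h : IsBoundary G S (pol.inc v ++ M)) (hv : v ∉ S) :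
    IsBoundary G (insert v S) (pol.out v ++ M) := by
  have hnd := List.nodup_append'.1 h.nodup
  have hM : ∀ e, e ∈ M ↔ G.src e ∈ S ∧ G.tgt e ∉ S ∧ G.tgt e ≠ v := by
    intro e
    have h1 := h.mem_iff e
    rw [List.mem_append, pol.mem_inc] at h1
    have h2 : e ∈ M → G.tgt e ≠ v := fun he he' => hnd.2.2 ((pol.mem_inc v e).2 he') he
    tauto
  refine ⟨List.nodup_append'.2 ⟨pol.nodup_out v, hnd.2.1, fun e he he' => ?_⟩, fun e => ?_,
    fun e he => ?_⟩
  · rw [pol.mem_out] at he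
    exact hv (he ▸ ((hM e).1 he').1)
  · have h1 : G.src e = v → G.tgt e ∉ S := fun he hs => hv (he ▸ h.closed e hs)
    have h2 := src_ne_tgt G e
    rw [List.mem_append, pol.mem_out, hM, Finset.mem_insert, Finset.mem_insert]
    have h3 : G.src e = v → G.tgt e ≠ v := fun h h' => h2 (h.trans h'.symm)
    tauto
  · rw [Finset.mem_insert] at he ⊢
    rcases he with he | he
    · exact .inr ((h.mem_iff e).1 (List.mem_append_left _ ((pol.mem_inc v e).2 he))).1
    · exact .inr (h.closed e he)

/-- The incoming edges of a node may be listed first if the sources of all of them are in `S`. -/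
theorem IsBoundary.exists_perm_append {G : DAG V E} (pol : G.Polarization) {S : Finset V}
    {L : List E} (h : IsBoundary G S L) {v : V} (hv : v ∉ S)
    (hS : ∀ e, G.tgt e = v → G.src e ∈ S) : ∃ M, L.Perm (pol.inc v ++ M) := by
  refine (pol.nodup_inc v).exists_perm_append_of_subset fun e he => ?_
  rw [pol.mem_inc] at he
  exact (h.mem_iff e).2 ⟨hS e he, he ▸ hv⟩

section

variable [BraidedCategory C] [DecidableEq V] {G : DAG V E} {pol : G.Polarization}
    {X : E → C} {g : ∀ v, tensorList X (pol.inc v) ⟶ tensorList X (pol.out v)}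

theorem FrontValue.isBoundary {S : Finset V} {L : List E} {s : 𝟙_ C ⟶ tensorList X L}
    (h : FrontValue pol X g S L s) : IsBoundary G S L := by
  induction h with
  | empty => exact ⟨List.nodup_nil, by simp, by simp⟩
  | perm _ hp ih => exact ih.perm hp.perm
  | node hv _ ih => exact ih.insert pol hv

theorem FrontValue.congr {g' : ∀ v, tensorList X (pol.inc v) ⟶ tensorList X (pol.out v)}
    {S : Finset V} {L : List E} {s : 𝟙_ C ⟶ tensorList X L} (h : FrontValue pol X g S L s)
    (hg : ∀ v ∈ S, g v = g' v) : FrontValue pol X g' S L s := by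
  induction h with
  | empty => exact .empty
  | perm _ hp ih => exact (ih hg).perm hp
  | @node S v M s hv _ ih =>
    rw [hg v (Finset.mem_insert_self _ _)]
    exact .node hv (ih fun v' hv' => hg v' (Finset.mem_insert_of_mem hv'))

/-- The last slices of a partial value: either there are no nodes, or a node is followed by
crossings. -/
theorem FrontValue.cases_last {S : Finset V} {L : List E} {s : 𝟙_ C ⟶ tensorList X L}
    (h : FrontValue pol X g S L s) :
    (S = ∅ ∧ PermHom X [] L s) ∨
    ∃ v S₀ M s₀ p, v ∉ S₀ ∧ S = insert v S₀ ∧ FrontValue pol X g S₀ (pol.inc v ++ M) s₀ ∧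
      PermHom X (pol.out v ++ M) L p ∧ s = s₀ ≫ padRight X (g v) M ≫ p := by
  induction h with
  | empty => exact .inl ⟨rfl, .refl _⟩
  | perm _ hp ih =>
    rcases ih with ⟨rfl, h⟩ | ⟨v, S₀, M, s₀, p, hv, rfl, h, hp', rfl⟩
    · exact .inl ⟨rfl, h.trans hp⟩
    · exact .inr ⟨v, S₀, M, s₀, _, hv, rfl, h, hp'.trans hp, by simp⟩
  | @node S v M s hv h ih =>
    exact .inr ⟨v, S, M, s, _, hv, rfl, h, .refl _, by simp⟩

end

section

variable [SymmetricCategory C] [DecidableEq V] {G : DAG V E} {pol : G.Polarization}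
    {X : E → C} {g : ∀ v, tensorList X (pol.inc v) ⟶ tensorList X (pol.out v)}

/-- A node may be applied anywhere, up to crossings. -/
theorem FrontValue.node_of_append {S : Finset V} {v : V} {L M : List E}
    {s : 𝟙_ C ⟶ tensorList X (L ++ (pol.inc v ++ M))} (hv : v ∉ S)
    (h : FrontValue pol X g S (L ++ (pol.inc v ++ M)) s) :
    FrontValue pol X g (insert v S) (L ++ (pol.out v ++ M))
      (s ≫ Diagram.padLeft X (Diagram.padRight X (g v) M) L) := by
  have h1 := (h.perm (permHom_blockSwap X L (pol.inc v) M)).node hv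
  have h2 := h1.perm (permHom_blockSwap X (pol.out v) L M)
  have hnd : (L ++ (pol.out v ++ M)).Nodup := by
    have := h2.isBoundary.nodup
    exact this
  -- The node is moved to the front, applied there and moved back. The swaps cancel because open
  -- wires are distinct.
  have h3 : blockSwap X L (pol.out v) M ≫ blockSwap X (pol.out v) L M = 𝟙 _ :=
    ((permHom_blockSwap X L _ M).trans (permHom_blockSwap X _ L M)).unique (.refl _) hnd
  convert! h2 using 1
  rw [Category.assoc, Category.assoc, ← reassoc_of% blockSwap_naturality, h3, Category.comp_id]

/-- Uniqueness is proved for the coarser `FrontValue`, existence for `PartialValue`, so this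
direction suffices. -/
theorem PartialValue.frontValue {S : Finset V} {L : List E} {s : 𝟙_ C ⟶ tensorList X L}
    (h : PartialValue pol X g S L s) : FrontValue pol X g S L s := by
  induction h with
  | empty => exact .empty
  | crossing S L M a b s _ ih => exact ih.perm ((PermHom.cross a b M).padLeft L)
  | node S v L M s hv _ ih => exact ih.node_of_append hv

end

end Values

end Diagram

/-! ### Sinks and sources of sets of nodes. -/

namespace DAG

variable {V E : Type*}

/-- A nonempty set of nodes has an element all of whose successors lie outside the set. -/
theorem exists_sink [Finite V] (G : DAG V E) {S : Set V} (hS : S.Nonempty) :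
    ∃ v ∈ S, ∀ e, G.src e = v → G.tgt e ∉ S := by
  let r : V → V → Prop := fun a b => Relation.TransGen (fun a b => ∃ e, G.src e = a ∧ G.tgt e = b) b a
  have : IsTrans V r := ⟨fun _ _ _ h h' => h'.trans h⟩
  have : Std.Irrefl r := ⟨G.acyclic⟩
  obtain ⟨v, hv, h⟩ := (Finite.wellFounded_of_trans_of_irrefl r).has_min S hS
  exact ⟨v, hv, fun e he he' => h _ he' (.single ⟨e, he, rfl⟩)⟩

/-- A nonempty set of nodes has an element all of whose predecessors lie outside the set. -/
theorem exists_source [Finite V] (G : DAG V E) {S : Set V} (hS : S.Nonempty) :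
    ∃ v ∈ S, ∀ e, G.tgt e = v → G.src e ∉ S := by
  let r : V → V → Prop := Relation.TransGen (fun a b => ∃ e, G.src e = a ∧ G.tgt e = b)
  have : IsTrans V r := ⟨fun _ _ _ h h' => h.trans h'⟩
  have : Std.Irrefl r := ⟨G.acyclic⟩
  obtain ⟨v, hv, h⟩ := (Finite.wellFounded_of_trans_of_irrefl r).has_min S hS
  exact ⟨v, hv, fun e he he' => h _ he' (.single ⟨e, rfl, he⟩)⟩

end DAG

namespace Diagram

variable {V E : Type*} {C : Type u} [Category.{w} C] [MonoidalCategory C]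

/-! ### Existence of values and their multilinearity. -/

section Existence

variable [SymmetricCategory C] [ConeEnriched C] [DecidableEq V] {G : DAG V E}

/-- `F` assigns a partial value to every labelling of the nodes, and is linear in the labels of the
nodes in `S`. -/
structure IsUniformValue (pol : G.Polarization) (X : E → C) (S : Finset V) (L : List E)
    (F : (∀ v, tensorList X (pol.inc v) ⟶ tensorList X (pol.out v)) → (𝟙_ C ⟶ tensorList X L)) :
    Prop where
  partialValue : ∀ g, PartialValue pol X g S L (F g)
  update_of_notMem : ∀ g v a, v ∉ S → F (Function.update g v a) = F g
  update_add : ∀ g v a b, v ∈ S → F (Function.update g v (a + b)) =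
    F (Function.update g v a) + F (Function.update g v b)
  update_smul : ∀ g v (r : ℝ≥0) a, v ∈ S → F (Function.update g v (r • a)) =
    r • F (Function.update g v a)

/-- The untouched prefix `K` absorbs the head in the `cons` case, so that crossings at any depth are
reached. -/
theorem IsUniformValue.perm {pol : G.Polarization} {X : E → C} {S : Finset V} {L L' : List E}
    (h : L.Perm L') : ∀ K : List E, (∃ F, IsUniformValue pol X S (K ++ L) F) →
      ∃ F, IsUniformValue pol X S (K ++ L') F := by
  induction h with
  | nil => exact fun _ h => h
  | cons e _ ih =>
    intro K hK
    rw [List.append_cons] at hK ⊢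
    exact ih _ hK
  | swap a b M =>
    rintro K ⟨F, hF⟩
    refine ⟨fun g => F g ≫ padLeft X (cross X b a M) K, fun g => .crossing _ _ _ _ _ _
      (hF.partialValue g), fun g v c hv => ?_, fun g v c d hv => ?_, fun g v r c hv => ?_⟩
    · simp only [hF.update_of_notMem g v c hv]
    · simp only [hF.update_add g v c d hv, ConeEnriched.add_comp]
    · simp only [hF.update_smul g v r c hv, ConeEnriched.smul_comp]
  | trans _ _ ih ih' => exact fun K hK => ih' K (ih K hK)

/-- Since `v ∉ S`, `F` ignores the label of `v`; that label enters only through the new slice, hence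
linearly. -/
theorem IsUniformValue.node {pol : G.Polarization} {X : E → C} {S : Finset V} {v : V} {M : List E}
    {F} (hF : IsUniformValue pol X S (pol.inc v ++ M) F) (hv : v ∉ S) :
    IsUniformValue pol X (insert v S) (pol.out v ++ M)
      (fun g => F g ≫ Diagram.padRight X (g v) M) := by
  refine ⟨fun g => .node S v [] M _ hv (hF.partialValue g), fun g w a hw => ?_,
    fun g w a b hw => ?_, fun g w r a hw => ?_⟩
  · rw [Finset.mem_insert, not_or] at hw
    rw [hF.update_of_notMem g w a hw.2, Function.update_of_ne (Ne.symm hw.1)]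
  · by_cases h : w = v
    · subst h
      simp only [hF.update_of_notMem g w _ hv, Function.update_self, padRight_add,
        ConeEnriched.comp_add]
    · have hw' := (Finset.mem_insert.1 hw).resolve_left h
      simp only [hF.update_add g w a b hw', Function.update_of_ne (Ne.symm h),
        ConeEnriched.add_comp]
  · by_cases h : w = v
    · subst h
      simp only [hF.update_of_notMem g w _ hv, Function.update_self, padRight_smul,
        ConeEnriched.comp_smul]
    · have hw' := (Finset.mem_insert.1 hw).resolve_left h
      simp only [hF.update_smul g w r a hw', Function.update_of_ne (Ne.symm h),
        ConeEnriched.smul_comp]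

/-- A sink of `S` can be applied last. The slices are chosen before the labels, which is what makes
multilinearity meaningful. -/
theorem exists_isUniformValue [Finite V] (pol : G.Polarization) (X : E → C) (S : Finset V)
    (hS : ∀ e, G.tgt e ∈ S → G.src e ∈ S) : ∃ L F, IsUniformValue pol X S L F := by
  induction hn : S.card generalizing S with
  | zero =>
    obtain rfl := Finset.card_eq_zero.1 hn
    exact ⟨[], fun _ => 𝟙 _, fun _ => .empty, fun _ _ _ _ => rfl,
      fun _ _ _ _ h => absurd h (Finset.notMem_empty _),
      fun _ _ _ _ h => absurd h (Finset.notMem_empty _)⟩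
  | succ n ih =>
    have hne : S.Nonempty := Finset.card_pos.1 (by omega)
    obtain ⟨v, hv, hmax⟩ := G.exists_sink (S := (S : Set V)) hne
    have hv' : v ∈ S := hv
    have hcl : ∀ e, G.tgt e ∈ S.erase v → G.src e ∈ S.erase v := fun e he =>
      Finset.mem_erase.2 ⟨fun h => hmax e h (Finset.mem_of_mem_erase he),
        hS e (Finset.mem_of_mem_erase he)⟩
    obtain ⟨L, F, hF⟩ := ih (S.erase v) hcl (by rw [Finset.card_erase_of_mem hv']; omega)
    -- The open wires do not depend on the labels; zero is just an available labelling.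
    have hb : IsBoundary G (S.erase v) L := (hF.partialValue fun _ => 0).frontValue.isBoundary
    obtain ⟨M, hM⟩ := hb.exists_perm_append pol (Finset.notMem_erase v S) fun e he =>
      Finset.mem_erase.2 ⟨fun h => hmax e h (he ▸ hv), hS e (he ▸ hv')⟩
    obtain ⟨F', hF'⟩ := IsUniformValue.perm hM [] ⟨F, hF⟩
    have := IsUniformValue.node hF' (Finset.notMem_erase v S)
    rw [Finset.insert_erase hv'] at this
    exact ⟨_, _, this⟩

theorem exists_isUniformValue_of_isBoundary [Finite V] (pol : G.Polarization) (X : E → C)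
    {S : Finset V} {L : List E} (hL : IsBoundary G S L) : ∃ F, IsUniformValue pol X S L F := by
  obtain ⟨L', F, hF⟩ := exists_isUniformValue pol X S hL.closed
  have hb : IsBoundary G S L' := (hF.partialValue fun _ => 0).frontValue.isBoundary
  exact IsUniformValue.perm (hb.perm_of hL) [] ⟨F, hF⟩

end Existence

/-! ### Independence of the slicing. -/

section Uniqueness

variable [SymmetricCategory C] [ConeEnriched C] [Finite V] [DecidableEq V] {G : DAG V E}
  {pol : G.Polarization} {X : E → C}
  {g : ∀ v, tensorList X (pol.inc v) ⟶ tensorList X (pol.out v)}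

/-- Two partial values with the same nodes differ by crossings only. -/
theorem FrontValue.eq_comp {S : Finset V} {L L' : List E} {s : 𝟙_ C ⟶ tensorList X L}
    {s' : 𝟙_ C ⟶ tensorList X L'} (h : FrontValue pol X g S L s)
    (h' : FrontValue pol X g S L' s') {q : tensorList X L ⟶ tensorList X L'}
    (hq : PermHom X L L' q) : s' = s ≫ q := by
  induction hn : S.card using Nat.strong_induction_on generalizing S L L' with
  | _ n ih =>
  subst hn
  have hb := h.isBoundary
  have hb' := h'.isBoundary
  rcases h.cases_last with ⟨rfl, hs⟩ | ⟨v, S₀, M, s₀, p, hv, rfl, h₀, hp, rfl⟩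
  · rcases h'.cases_last with ⟨-, hs'⟩ | ⟨v, S₀, M, s₀, p, hv, hS, -⟩
    · exact hs'.unique (hs.trans hq) List.nodup_nil
    · exact absurd hS.symm (Finset.insert_ne_empty _ _)
  rcases h'.cases_last with ⟨hS, -⟩ | ⟨w, S₁, N, s₁, p', hw, hS, h₁, hp', rfl⟩
  · exact absurd hS (Finset.insert_ne_empty _ _)
  have hc₀ : S₀.card < (insert v S₀).card := by rw [Finset.card_insert_of_notMem hv]; omega
  have hc₁ : S₁.card < (insert v S₀).card := by
    rw [hS, Finset.card_insert_of_notMem hw]; omega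
  have hb₀ := h₀.isBoundary
  have hb₁ := h₁.isBoundary
  -- With the same last node, the earlier states differ by crossings of the wires behind its inputs,
  -- and these slide past the node.
  by_cases hvw : v = w
  · subst hvw
    obtain rfl : S₀ = S₁ := by
      rw [← Finset.erase_insert hv, hS, Finset.erase_insert hw]
    obtain ⟨r, hr⟩ := PermHom.exists_of_perm X
      ((List.perm_append_left_iff _).1 (hb₀.perm_of hb₁))
    rw [ih _ hc₀ h₀ h₁ (hr.padLeft _) rfl]
    simp only [Category.assoc]
    rw [reassoc_of% padLeft_comp_padRight,
      ((hr.padLeft _).trans hp').unique (hp.trans hq) (hp.perm.nodup_iff.2 hb.nodup)]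
  · have hwS : w ∈ S₀ := by
      have : w ∈ insert v S₀ := hS ▸ Finset.mem_insert_self _ _
      exact (Finset.mem_insert.1 this).resolve_left (Ne.symm hvw)
    have hvS : v ∈ S₁ := by
      have : v ∈ insert w S₁ := hS ▸ Finset.mem_insert_self _ _
      exact (Finset.mem_insert.1 this).resolve_left hvw
    obtain ⟨S, hwS', rfl⟩ : ∃ S, w ∉ S ∧ insert w S = S₀ :=
      ⟨_, Finset.notMem_erase w S₀, Finset.insert_erase hwS⟩
    have hvS' : v ∉ S := fun h => hv (Finset.mem_insert_of_mem h)
    obtain rfl : insert v S = S₁ := by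
      rw [← Finset.erase_insert hw, ← hS, Finset.insert_comm, Finset.erase_insert]
      rw [Finset.mem_insert, not_or]
      exact ⟨Ne.symm hvw, hwS'⟩
    have hmem : ∀ x, x ∈ insert w S → x ∈ insert v S → x ∈ S := by
      intro x h1 h2
      rw [Finset.mem_insert] at h1 h2
      rcases h1 with rfl | h1
      · exact h2.resolve_left (Ne.symm hvw)
      · exact h1
    -- Here `S` is the intersection of the two earlier sets. It is closed under predecessors and
    -- contains the sources of all inputs of `v` and `w`, so neither node feeds the other.
    have hcl : ∀ e, G.tgt e ∈ S → G.src e ∈ S := fun e he =>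
      hmem _ (hb₀.closed e (Finset.mem_insert_of_mem he)) (hb₁.closed e (Finset.mem_insert_of_mem he))
    have hinv : ∀ e, G.tgt e = v → G.src e ∈ S := fun e he =>
      hmem _ ((hb₀.mem_iff e).1 (List.mem_append_left _ ((pol.mem_inc v e).2 he))).1
        (hb₁.closed e (he ▸ hvS))
    have hinw : ∀ e, G.tgt e = w → G.src e ∈ S := fun e he =>
      hmem _ (hb₀.closed e (he ▸ hwS))
        ((hb₁.mem_iff e).1 (List.mem_append_left _ ((pol.mem_inc w e).2 he))).1
    obtain ⟨K, F, hF⟩ := exists_isUniformValue pol X S hcl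
    have hK := (hF.partialValue g).frontValue
    obtain ⟨K₁, hK₁⟩ := hK.isBoundary.exists_perm_append pol hvS' hinv
    obtain ⟨k, hk⟩ := PermHom.exists_of_perm X hK₁
    have ht := hK.perm hk
    obtain ⟨J, hJ⟩ : ∃ J, K₁.Perm (pol.inc w ++ J) := by
      refine (pol.nodup_inc w).exists_perm_append_of_subset fun e he => ?_
      have hw := (pol.mem_inc w e).1 he
      have := (ht.isBoundary.mem_iff e).2 ⟨hinw e hw, hw ▸ hwS'⟩
      exact (List.mem_append.1 this).resolve_left fun h =>
        hvw (((pol.mem_inc v e).1 h).symm.trans hw)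
    obtain ⟨j, hj⟩ := PermHom.exists_of_perm X hJ
    have ht := ht.perm (hj.padLeft (pol.inc v))
    generalize (F g ≫ k) ≫ padLeft X j (pol.inc v) = t at ht
    -- From the common state `t`, each node is applied so that the inputs of the other come first.
    -- By induction the results agree with `s₀` and `s₁` up to crossings of the remaining wires.
    have hw₂ := ht.node_of_append hwS'
    have hv₂ := (ht.node hvS').perm (permHom_blockSwap X _ _ _)
    obtain ⟨r, hr⟩ := PermHom.exists_of_perm X
      ((List.perm_append_left_iff _).1 (hw₂.isBoundary.perm_of hb₀))
    obtain ⟨r', hr'⟩ := PermHom.exists_of_perm X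
      ((List.perm_append_left_iff _).1 (hv₂.isBoundary.perm_of hb₁))
    rw [ih _ hc₀ hw₂ h₀ (hr.padLeft _) rfl, ih _ hc₁ hv₂ h₁ (hr'.padLeft _) rfl]
    simp only [Category.assoc]
    rw [reassoc_of% padLeft_comp_padRight, reassoc_of% padLeft_comp_padRight,
      ← reassoc_of% blockSwap_naturality, reassoc_of% padLeft_comp_padRight]
    have hfin := ((hr.padLeft (pol.out v)).trans hp)
    rw [((permHom_blockSwap X _ _ _).trans ((hr'.padLeft _).trans hp')).unique (hfin.trans hq)
      (hfin.perm.nodup_iff.2 hb.nodup)]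
    simp only [Category.assoc]

theorem FrontValue.unique {S : Finset V} {L : List E} {s s' : 𝟙_ C ⟶ tensorList X L}
    (h : FrontValue pol X g S L s) (h' : FrontValue pol X g S L s') : s = s' := by
  simpa using (h.eq_comp h' (.refl _)).symm

end Uniqueness

/-! ### Diagrams side by side. -/

section Juxtaposition

/-- Two states next to each other. -/
def juxtapose (X : E → C) {L K : List E} (s : 𝟙_ C ⟶ tensorList X L) (t : 𝟙_ C ⟶ tensorList X K) :
    𝟙_ C ⟶ tensorList X (L ++ K) :=
  (λ_ (𝟙_ C)).inv ≫ (s ⊗ₘ t) ≫ (appendIso X L K).inv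

theorem juxtapose_comp (X : E → C) {L L' K : List E} (s : 𝟙_ C ⟶ tensorList X L)
    (p : tensorList X L ⟶ tensorList X L') (t : 𝟙_ C ⟶ tensorList X K) :
    juxtapose X (s ≫ p) t = juxtapose X s t ≫ padRight X p K := by
  simp [juxtapose, padRight, tensorHom_def']

variable [SymmetricCategory C] [DecidableEq V] {G : DAG V E} {pol : G.Polarization}
    {X : E → C} {g : ∀ v, tensorList X (pol.inc v) ⟶ tensorList X (pol.out v)}

/-- The slices of `s` are replayed to the left of the finished state `t`. -/
theorem FrontValue.juxtapose {S S' : Finset V} {L K : List E} {s : 𝟙_ C ⟶ tensorList X L}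
    {t : 𝟙_ C ⟶ tensorList X K} (hs : FrontValue pol X g S L s) (ht : FrontValue pol X g S' K t)
    (hd : Disjoint S S') : FrontValue pol X g (S ∪ S') (L ++ K) (juxtapose X s t) := by
  induction hs with
  | empty =>
    rw [Finset.empty_union]
    have key : ∀ {Y : C} (t : 𝟙_ C ⟶ Y), (λ_ (𝟙_ C)).inv ≫ (𝟙 (𝟙_ C) ⊗ₘ t) ≫ (λ_ Y).hom = t := by
      intro Y t
      simp
    convert! ht
    exact key t
  | perm _ hp ih =>
    rw [juxtapose_comp]
    exact (ih hd).perm (hp.padRight K)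
  | @node S v M s hv _ ih =>
    rw [Finset.disjoint_insert_left] at hd
    rw [Finset.insert_union, juxtapose_comp, padRight_padRight, ← Category.assoc, ← Category.assoc]
    refine FrontValue.perm (.node ?_ ((ih hd.2).perm (permHom_appendAssocIso_hom X _ M K)))
      (permHom_appendAssocIso_inv X _ M K)
    rw [Finset.mem_union, not_or]
    exact ⟨hv, hd.1⟩

end Juxtaposition

/-! ### Structural morphisms are normalized. -/

section Normalized

variable [SymmetricCategory C] (N : MorphismProperty C) [N.IsStableUnderBraiding]

theorem normalized_appendIso (X : E → C) (L M : List E) :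
    N (appendIso X L M).hom ∧ N (appendIso X L M).inv := by
  induction L with
  | nil => exact ⟨N.leftUnitor_inv_mem _, N.leftUnitor_hom_mem _⟩
  | cons e L ih =>
    exact ⟨N.comp_mem _ _ (N.whiskerLeft_mem _ _ ih.1) (N.associator_inv_mem _ _ _),
      N.comp_mem _ _ (N.associator_hom_mem _ _ _) (N.whiskerLeft_mem _ _ ih.2)⟩

theorem normalized_padRight (X : E → C) {A B : List E} {f : tensorList X A ⟶ tensorList X B}
    (hf : N f) (M : List E) : N (padRight X f M) :=
  N.comp_mem _ _ (normalized_appendIso N X A M).1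
    (N.comp_mem _ _ (N.whiskerRight_mem _ hf _) (normalized_appendIso N X B M).2)

variable {N} in
theorem PermHom.normalized {X : E → C} {L L' : List E} {p : tensorList X L ⟶ tensorList X L'}
    (h : PermHom X L L' p) : N p := by
  induction h with
  | refl => exact N.id_mem _
  | cross a b M =>
    exact N.comp_mem _ _ (N.associator_inv_mem _ _ _)
      (N.comp_mem _ _ (N.whiskerRight_mem _ (N.braiding_hom_mem _ _) _) (N.associator_hom_mem _ _ _))
  | cons e _ ih => exact N.whiskerLeft_mem _ _ ih
  | trans _ _ ih ih' => exact N.comp_mem _ _ ih ih'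

end Normalized

/-! ### Discarding open wires. -/

section Discard

variable [SymmetricCategory C] (N : MorphismProperty C) [DecidableEq V] {G : DAG V E}
  (pol : G.Polarization) (X : E → C)

/-- `z` is obtained from a partial value with nodes `S` by discarding all its wires. -/
def IsDiscardedValue (g : ∀ v, tensorList X (pol.inc v) ⟶ tensorList X (pol.out v))
    (S : Finset V) (z : 𝟙_ C ⟶ 𝟙_ C) : Prop :=
  ∃ L s d, FrontValue pol X g S L s ∧ N d ∧ z = s ≫ d

variable {pol X} {N} {g : ∀ v, tensorList X (pol.inc v) ⟶ tensorList X (pol.out v)}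

theorem IsDiscardedValue.congr {g' : ∀ v, tensorList X (pol.inc v) ⟶ tensorList X (pol.out v)}
    {S : Finset V} {z : 𝟙_ C ⟶ 𝟙_ C} (h : IsDiscardedValue N pol X g S z)
    (hg : ∀ v ∈ S, g v = g' v) : IsDiscardedValue N pol X g' S z := by
  obtain ⟨L, s, d, hs, hd, hz⟩ := h
  exact ⟨L, s, d, hs.congr hg, hd, hz⟩

theorem isDiscardedValue_empty [N.IsStableUnderBraiding] :
    IsDiscardedValue N pol X g ∅ (𝟙 _) :=
  ⟨[], 𝟙 (𝟙_ C), 𝟙 (𝟙_ C), .empty, N.id_mem _, (Category.id_comp _).symm⟩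

/-- States and discards are tensored; on endomorphisms of the unit, tensoring is composition because
the two unitors of the unit agree. -/
theorem IsDiscardedValue.union [N.IsStableUnderBraiding] {S T : Finset V} {z z' : 𝟙_ C ⟶ 𝟙_ C}
    (h : IsDiscardedValue N pol X g S z) (h' : IsDiscardedValue N pol X g T z')
    (hST : Disjoint S T) : IsDiscardedValue N pol X g (S ∪ T) (z ≫ z') := by
  obtain ⟨L, s, d, hs, hd, rfl⟩ := h
  obtain ⟨K, t, d', ht, hd', rfl⟩ := h'
  refine ⟨_, _, (appendIso X L K).hom ≫ (d ⊗ₘ d') ≫ (λ_ _).hom, hs.juxtapose ht hST, ?_, ?_⟩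
  · exact N.comp_mem _ _ (normalized_appendIso N X L K).1
      (N.comp_mem _ _ (N.tensorHom_mem _ _ hd hd') (N.leftUnitor_hom_mem _))
  · simp only [juxtapose, Category.assoc, Iso.inv_hom_id_assoc]
    rw [tensorHom_comp_tensorHom_assoc, MonoidalCategory.tensorHom_def]
    rw [← Category.assoc s d]
    generalize s ≫ d = x
    generalize t ≫ d' = y
    rw [Category.assoc, leftUnitor_naturality, unitors_equal, rightUnitor_naturality_assoc,
      ← unitors_equal, Iso.inv_hom_id_assoc]

variable (hterminal : ∀ X : C, ∃! t : X ⟶ 𝟙_ C, N t)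

include hterminal

theorem IsDiscardedValue.exists [ConeEnriched C] [Finite V] {S : Finset V}
    (hS : ∀ e, G.tgt e ∈ S → G.src e ∈ S) : ∃ z, IsDiscardedValue N pol X g S z := by
  obtain ⟨L, F, hF⟩ := exists_isUniformValue pol X S hS
  obtain ⟨d, hd, -⟩ := hterminal (tensorList X L)
  exact ⟨_, L, F g, d, (hF.partialValue g).frontValue, hd, rfl⟩

variable [N.IsStableUnderBraiding]

theorem IsDiscardedValue.unique [ConeEnriched C] [Finite V] {S : Finset V} {z z' : 𝟙_ C ⟶ 𝟙_ C}
    (h : IsDiscardedValue N pol X g S z) (h' : IsDiscardedValue N pol X g S z') : z = z' := by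
  obtain ⟨L, s, d, hs, hd, rfl⟩ := h
  obtain ⟨L', s', d', hs', hd', rfl⟩ := h'
  obtain ⟨p, hp⟩ := PermHom.exists_of_perm X (hs.isBoundary.perm_of hs'.isBoundary)
  rw [hs.eq_comp hs' hp, Category.assoc,
    (hterminal _).unique hd (N.comp_mem _ _ hp.normalized hd')]

/-- A normalized node followed by discarding is again normalized, so by uniqueness it is the
discarding of the wires before it. -/
theorem IsDiscardedValue.insert {S : Finset V} {z : 𝟙_ C ⟶ 𝟙_ C}
    (h : IsDiscardedValue N pol X g S z) {v : V} (hv : v ∉ S)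
    (hin : ∀ e, G.tgt e = v → G.src e ∈ S) (hg : N (g v)) :
    IsDiscardedValue N pol X g (insert v S) z := by
  obtain ⟨L, s, d, hs, hd, rfl⟩ := h
  obtain ⟨M, hM⟩ := hs.isBoundary.exists_perm_append pol hv hin
  obtain ⟨p, hp⟩ := PermHom.exists_of_perm X hM
  obtain ⟨d', hd', -⟩ := hterminal (tensorList X (pol.out v ++ M))
  refine ⟨_, _, d', (hs.perm hp).node hv, hd', ?_⟩
  rw [Category.assoc, Category.assoc, (hterminal _).unique hd (N.comp_mem _ _ hp.normalized
    (N.comp_mem _ _ (normalized_padRight N X hg M) hd'))]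

/-- Normalized nodes outside a set containing its causal past do not change the value. -/
theorem IsDiscardedValue.mono [Finite V] {S T : Finset V} {z : 𝟙_ C ⟶ 𝟙_ C}
    (h : IsDiscardedValue N pol X g S z) (hST : S ⊆ T) (hT : ∀ e, G.tgt e ∈ T → G.src e ∈ T)
    (hg : ∀ v ∈ T, v ∉ S → N (g v)) : IsDiscardedValue N pol X g T z := by
  induction hn : (T \ S).card generalizing S with
  | zero =>
    have : T ⊆ S := Finset.sdiff_eq_empty_iff_subset.1 (Finset.card_eq_zero.1 hn)
    rwa [← hST.antisymm this]
  | succ n ih =>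
    -- A source among the missing nodes has all its predecessors in `S` already.
    obtain ⟨v, hv, hmin⟩ := G.exists_source (S := ((T \ S : Finset V) : Set V))
      (Finset.card_pos.1 (by omega))
    simp only [Finset.mem_coe, Finset.mem_sdiff, not_and, not_not] at hv hmin
    refine ih (h.insert hterminal hv.2 (fun e he => hmin e he (hT e (he ▸ hv.1))) (hg v hv.1 hv.2))
      (Finset.insert_subset hv.1 hST) (fun w hw hw' => hg w hw fun h =>
        hw' (Finset.mem_insert_of_mem h)) ?_
    rw [Finset.sdiff_insert, Finset.card_erase_of_mem (Finset.mem_sdiff.2 hv)]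
    omega

end Discard

end Diagram

/-! ### Marginals and the main theorem. -/

theorem DAG.src_mem_past {V E : Type*} (G : DAG V E) (U : Set V) (e : E)
    (h : G.tgt e ∈ G.past U) : G.src e ∈ G.past U := by
  obtain ⟨v, hv, h⟩ := h
  exact ⟨v, hv, .head ⟨e, rfl, rfl⟩ h⟩

theorem DAG.subset_past {V E : Type*} (G : DAG V E) (U : Set V) : U ⊆ G.past U :=
  fun v hv => ⟨v, hv, .refl⟩

open scoped Classical in
/-- The marginals are the values of the diagrams in which the outcomes of the remaining nodes are
summed up. -/
theorem DAG.marginal_smul_eq {C : Type u} [Category.{w} C] [MonoidalCategory C] [ConeEnriched C]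
    {V : Type*} [Fintype V] {O : V → Type*} [∀ v, Fintype (O v)] {A B : V → C} {Y Z : C}
    (F : MultilinearMap ℝ≥0 (fun v => A v ⟶ B v) (Y ⟶ Z)) (f : ∀ v, O v → (A v ⟶ B v))
    {P : (∀ v, O v) → ℝ≥0} {i : Y ⟶ Z} (hP : ∀ o, P o • i = F fun v => f v (o v))
    (U : Set V) (o : ∀ v, O v) :
    DAG.marginal P U o • i = F fun v => if v ∈ U then f v (o v) else ∑ x, f v x := by
  -- Summing over a singleton at the nodes of `U` and over everything elsewhere runs through exactly
  -- the outcomes that agree with `o` on `U`.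
  have h := F.map_sum_finset f fun v => if v ∈ U then {o v} else Finset.univ
  have h1 : (fun v => ∑ x ∈ (if v ∈ U then {o v} else Finset.univ), f v x) =
      fun v => if v ∈ U then f v (o v) else ∑ x, f v x := by
    funext v
    split_ifs <;> simp
  rw [h1] at h
  rw [h, DAG.marginal, ← Finset.sum_filter, Finset.sum_smul]
  refine Finset.sum_congr ?_ fun o' _ => hP o'
  ext o'
  simp only [Finset.mem_filter, Finset.mem_univ, true_and, Fintype.mem_piFinset]
  refine forall_congr' fun v => ?_
  split_ifs with hv <;> simp [hv]

theorem mainTheorem3 {C : Type u} [Category.{w} C] [MonoidalCategory C] [SymmetricCategory C]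
    [ConeEnriched C]
    -- the normalized morphisms: a symmetric monoidal subcategory with all objects of `C`
    (N : MorphismProperty C) [N.IsStableUnderBraiding]
    -- every endomorphism of the unit is a unique nonnegative multiple of the identity
    (hscalar : Function.Bijective (fun r : ℝ≥0 => r • 𝟙 (𝟙_ C)))
    -- the unit is terminal among the normalized morphisms
    (hterminal : ∀ X : C, ∃! t : X ⟶ 𝟙_ C, N t)
    {V E : Type*} [Fintype V] [DecidableEq V] (G : DAG V E) (pol : G.Polarization)
    (O : V → Type*) [∀ v, Fintype (O v)] (X : E → C)
    -- an instrument at every node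
    (f : ∀ v, O v → (Diagram.tensorList X (pol.inc v) ⟶ Diagram.tensorList X (pol.out v)))
    (hf : ∀ v, N (∑ x : O v, f v x)) :
    ∃ P : (∀ v, O v) → ℝ≥0,
      -- for every joint outcome `o` the diagram has exactly one value, the number `P o`
      (∀ (o : ∀ v, O v) (z : 𝟙_ C ⟶ 𝟙_ C),
        Diagram.IsValue pol X (fun v => f v (o v)) z ↔ z = P o • 𝟙 (𝟙_ C)) ∧
      G.IsCorrelation P := by
  have hb : Diagram.IsBoundary G (Finset.univ : Finset V) [] :=
    ⟨List.nodup_nil, by simp, by simp⟩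
  obtain ⟨F₀, hF⟩ := Diagram.exists_isUniformValue_of_isBoundary pol X hb
  let F : MultilinearMap ℝ≥0
      (fun v => Diagram.tensorList X (pol.inc v) ⟶ Diagram.tensorList X (pol.out v))
      (𝟙_ C ⟶ 𝟙_ C) :=
    MultilinearMap.mk' F₀ (fun g v a b => hF.update_add g v a b (Finset.mem_univ v))
      (fun g v r a => hF.update_smul g v r a (Finset.mem_univ v))
  have hval : ∀ g z, Diagram.IsValue pol X g z ↔ z = F g := by
    refine fun g z => ⟨fun h => ?_, fun h => by rw [h]; exact hF.partialValue g⟩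
    exact Diagram.FrontValue.unique (Diagram.PartialValue.frontValue h)
      (hF.partialValue g).frontValue
  choose P hP using fun o : ∀ v, O v => hscalar.2 (F fun v => f v (o v))
  have hdisc : ∀ g z, Diagram.IsDiscardedValue N pol X g Finset.univ z ↔ z = F g := by
    intro g z
    have h : Diagram.IsDiscardedValue N pol X g Finset.univ (F g) :=
      ⟨[], F g, 𝟙 (𝟙_ C), (hF.partialValue g).frontValue, N.id_mem _, (Category.comp_id _).symm⟩
    exact ⟨fun h' => h'.unique hterminal h, fun h' => by rw [h']; exact h⟩
  classical
  let r (U : Set V) (o : ∀ v, O v) (v : V) :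
      Diagram.tensorList X (pol.inc v) ⟶ Diagram.tensorList X (pol.out v) :=
    if v ∈ U then f v (o v) else ∑ x, f v x
  have hr : ∀ (U : Set V) (o : ∀ v, O v) v, v ∉ U → N (r U o v) := by
    intro U o v hv
    simp only [r, if_neg hv]
    exact hf v
  have hmarg : ∀ (U : Set V) (o : ∀ v, O v), DAG.marginal P U o • 𝟙 (𝟙_ C) = F (r U o) :=
    fun U o => DAG.marginal_smul_eq F f hP U o
  have hind : ∀ (m : ℕ) (U : Fin m → Set V),
      (∀ i j, i ≠ j → Disjoint (G.past (U i)) (G.past (U j))) →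
      ∀ o : (∀ v, O v), DAG.marginal P (⋃ i, U i) o = ∏ i, DAG.marginal P (U i) o := by
    intro m U hU o
    refine hscalar.1 ?_
    simp only [hmarg]
    symm
    -- Each factor is computed on the past of `U i` alone, but with the labelling of the union, so
    -- that the factors can be juxtaposed.
    have hpast : ∀ i, Diagram.IsDiscardedValue N pol X (r (⋃ i, U i) o) (G.past (U i)).toFinset
        (DAG.marginal P (U i) o • 𝟙 (𝟙_ C)) := by
      intro i
      obtain ⟨z, hz⟩ := Diagram.IsDiscardedValue.exists (pol := pol) (X := X) (g := r (U i) o)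
        hterminal (S := (G.past (U i)).toFinset) (by simpa using G.src_mem_past (U i))
      have hz' := hz.mono hterminal (Finset.subset_univ _) (by simp) (fun v _ hv => hr _ _ _
        fun h => hv (by simpa using G.subset_past _ h))
      rw [hmarg, ← (hdisc _ _).1 hz']
      refine hz.congr fun v hv => ?_
      -- A node of the past of `U i` lies in no other `U j`, because the pasts are disjoint; hence
      -- the two labellings agree there.
      have : v ∈ U i ↔ v ∈ ⋃ i, U i := by
        rw [Set.mem_iUnion]
        refine ⟨fun h => ⟨i, h⟩, fun ⟨j, hj⟩ => ?_⟩
        by_contra h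
        have hij : i ≠ j := fun hij => h (hij ▸ hj)
        exact Set.disjoint_left.1 (hU i j hij) (by simpa using hv) (G.subset_past _ hj)
      simp only [r, this]
    have hprod : ∀ I : Finset (Fin m), Diagram.IsDiscardedValue N pol X (r (⋃ i, U i) o)
        (I.biUnion fun i => (G.past (U i)).toFinset)
        ((∏ i ∈ I, DAG.marginal P (U i) o) • 𝟙 (𝟙_ C)) := by
      intro I
      induction I using Finset.induction_on with
      | empty => simpa using Diagram.isDiscardedValue_empty
      | insert i I hi ih =>
        rw [Finset.biUnion_insert, Finset.prod_insert hi]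
        have := (hpast i).union ih (by
          rw [Finset.disjoint_biUnion_right]
          intro j hj
          rw [Set.disjoint_toFinset]
          exact hU i j fun h => hi (h ▸ hj))
        rwa [ConeEnriched.smul_comp, Category.id_comp, smul_smul] at this
    refine (hdisc _ _).1 ((hprod Finset.univ).mono hterminal (Finset.subset_univ _) (by simp)
      fun v _ hv => hr _ _ _ fun h => hv ?_)
    obtain ⟨i, hi⟩ := Set.mem_iUnion.1 h
    simp only [Finset.mem_biUnion, Finset.mem_univ, true_and, Set.mem_toFinset]
    exact ⟨i, G.subset_past _ hi⟩
  refine ⟨P, fun o z => ?_, ?_, hind⟩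
  · rw [hval, ← hP o]
  · refine hscalar.1 ?_
    -- Every node is now normalized, so the whole diagram is absorbed starting from the empty one.
    have hsum : F (fun v => ∑ x, f v x) = 𝟙 (𝟙_ C) := ((hdisc _ _).1
      ((Diagram.isDiscardedValue_empty (pol := pol) (X := X)).mono hterminal
        (Finset.subset_univ _) (by simp) fun v _ _ => hf v)).symm
    simp only [Finset.sum_smul, hP, one_smul]
    rw [← F.map_sum, hsum]
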